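/- Let $\mathbb{A}$ be the ring of adeles of $\mathbb{Q}$, i.e. the set of all $\alpha=(\alpha_\infty,\alpha_2,\alpha_3,\alpha_5,\ldots)\in\mathbb{R}\times\prod_p\mathbb{Q}_p$ with $\alpha_p\in\mathbb{Z}_p$ for all but finitely many primes $p$, with the restricted product topology. Embed $\mathbb{Q}$ diagonally in $\mathbb{A}$, let $X=\mathbb{A}/\mathbb{Q}$ be the (compact) quotient group, and let $|\cdot|$ denote Haar probability measure on the Borel sets of $X$. For $\alpha\in X$ let $T_\alpha:X\to X$ be the rotation $T_\alpha(x)=x+\alpha$. A bounded remainder set for $T_\alpha$ is a finite multiset sum $A=A_1+\cdots+A_k$ of measurable sets $A_i\subseteq X$, with $\chi_A=\sum_{i=1}^k\chi_{A_i}$ and volume $|A|=\sum_{i=1}^k|A_i|$, for which there is a constant $C=C(A)>0$ such that, for almost every $x\in X$ and for every $N\in\mathbb{N}$, $$\left|\sum_{n=0}^{N-1}\chi_A(x+n\alpha)-N|A|\right|\le C.$$ For $x=\sum_{i\ge -N}b_ip^i\in\mathbb{Q}_p$ with $N\ge 0$ and $b_i\in\{0,1,\ldots,p-1\}$, let $\{x\}_p=\sum_{i=-N}^{-1}b_ip^i\in\mathbb{Q}$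 be its $p$-adic fractional part. Theorem. Let $\alpha\in X$ be represented by $(\alpha_\infty,\alpha_2,\alpha_3,\ldots)\in\mathbb{A}$, and suppose that $\alpha_\infty\notin\mathbb{Q}$. Then the set of all volumes of bounded remainder sets for $T_\alpha$ is $$\left\{-\gamma\alpha_\infty+\sum_p\{\gamma\alpha_p\}_p+n\ge 0:\gamma\in\mathbb{Q},\ n\in\mathbb{Z}\right\},$$ where the sum runs over all primes $p$ and has only finitely many nonzero terms. -/

import Mathlib

open MeasureTheory TopologicalSpace Set
open scoped RestrictedProduct

/-! ### General notions: rotations and bounded remainder sets -/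

section BoundedRemainder

variable {G : Type*} [AddCommGroup G] [MeasurableSpace G]

/-- The rotation `T_α : x ↦ x + α`. -/
def rotationBy (α : G) : G → G := fun x => x + α

/-- The counting function `χ_A` of the multiset `A = A₁ + ⋯ + A_k`: the sum of the indicator
functions of the sets `A i`. -/
noncomputable def multisetIndicator {k : ℕ} (A : Fin k → Set G) (x : G) : ℝ :=
  ∑ i, (A i).indicator (fun _ => (1 : ℝ)) x

/-- The volume `|A|` of a multiset: each set is counted with its multiplicity. -/
noncomputable def multisetVolume (μ : Measure G) {k : ℕ} (A : Fin k → Set G) : ℝ :=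
  ∑ i, μ.real (A i)

/-- The multiset `A` (a finite sum of measurable sets) is a bounded remainder set for the rotation
`T_α`: the discrepancies of almost every orbit are bounded by a constant depending only on `A`
(for the given rotation). Here `T_α^n x = x + n α`. -/
def IsBoundedRemainderSet (μ : Measure G) (α : G) {k : ℕ} (A : Fin k → Set G) : Prop :=
  (∀ i, MeasurableSet (A i)) ∧
    ∃ C : ℝ, 0 < C ∧ ∀ᵐ x ∂μ, ∀ N : ℕ,
      |∑ n ∈ Finset.range N, multisetIndicator A ((rotationBy α)^[n] x) - N * multisetVolume μ A| ≤ C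

/-- The set of all volumes of bounded remainder sets for the rotation `T_α`. -/
def boundedRemainderVolumes (μ : Measure G) (α : G) : Set ℝ :=
  {v | ∃ (k : ℕ) (A : Fin k → Set G), IsBoundedRemainderSet μ α A ∧ multisetVolume μ A = v}

end BoundedRemainder

/-! ### The `p`-adic fractional part -/

theorem padic_norm_mul_pow_le_one (p : ℕ) [Fact p.Prime] (x : ℚ_[p]) :
    ‖x * (p : ℚ_[p]) ^ (-x.valuation).toNat‖ ≤ 1 := by
  have hp : (1 : ℝ) < p := by exact_mod_cast (Fact.out : p.Prime).one_lt
  by_cases hx : x = 0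
  · simp [hx]
  rw [norm_mul, norm_pow, Padic.norm_p, Padic.norm_eq_zpow_neg_valuation hx, inv_pow,
    ← zpow_natCast, ← zpow_neg, ← zpow_add₀ (by positivity)]
  apply zpow_le_one_of_nonpos₀ hp.le
  have := Int.self_le_toNat (-x.valuation)
  linarith

/-- The `p`-adic fractional part `{x}_p = ∑_{-N ≤ i < 0} b_i p^i` of
`x = ∑_{i ≥ -N} b_i p^i`, with digits `0 ≤ b_i < p`. For `N = max (0, -v_p(x))` the number
`x p^N` is a `p`-adic integer, and `PadicInt.appr z N` is the sum of the first `N` terms of the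
`p`-adic expansion of `z`, i.e. the natural number below `p^N` that is congruent to `z`
modulo `p^N`. See `padicFract_eq_of_expansion`. -/
noncomputable def padicFract (p : ℕ) [Fact p.Prime] (x : ℚ_[p]) : ℚ :=
  (PadicInt.appr ⟨x * (p : ℚ_[p]) ^ (-x.valuation).toNat, padic_norm_mul_pow_le_one p x⟩
    (-x.valuation).toNat : ℚ) / (p : ℚ) ^ (-x.valuation).toNat

theorem padicFract_spec (p : ℕ) [Fact p.Prime] (x : ℚ_[p]) :
    (∃ N m : ℕ, m < p ^ N ∧ padicFract p x = (m : ℚ) / (p : ℚ) ^ N) ∧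
      ‖x - (padicFract p x : ℚ_[p])‖ ≤ 1 := by
  refine ⟨⟨_, _, PadicInt.appr_lt _ _, rfl⟩, ?_⟩
  have hp0 : (p : ℚ_[p]) ≠ 0 := by exact_mod_cast (Fact.out : p.Prime).ne_zero
  have key : ∀ (N : ℕ) (z : ℤ_[p]), (z : ℚ_[p]) = x * (p : ℚ_[p]) ^ N →
      ‖x - (((z.appr N : ℚ) / (p : ℚ) ^ N : ℚ) : ℚ_[p])‖ ≤ 1 := by
    intro N z hz
    obtain ⟨c, hc⟩ := Ideal.mem_span_singleton.mp (PadicInt.appr_spec N z)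
    have h : (z : ℚ_[p]) - (z.appr N : ℚ_[p]) = (p : ℚ_[p]) ^ N * c := by
      have h := congrArg (fun z : ℤ_[p] => (z : ℚ_[p])) hc
      push_cast at h
      exact h
    push_cast
    rw [show x - (z.appr N : ℚ_[p]) / (p : ℚ_[p]) ^ N = c by
      field_simp
      linear_combination h - hz]
    exact c.2
  exact key _ _ rfl

theorem padicFract_unique (p : ℕ) [Fact p.Prime] (x : ℚ_[p]) (N m : ℕ) (hm : m < p ^ N)
    (h : ‖x - (m : ℚ_[p]) / (p : ℚ_[p]) ^ N‖ ≤ 1) : padicFract p x = (m : ℚ) / (p : ℚ) ^ N := by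
  have hp : (p : ℚ) ≠ 0 := by exact_mod_cast (Fact.out : p.Prime).ne_zero
  have hp0 : (p : ℚ_[p]) ≠ 0 := by exact_mod_cast (Fact.out : p.Prime).ne_zero
  obtain ⟨⟨M, a, ha, hfa⟩, hf⟩ := padicFract_spec p x
  rw [hfa] at hf ⊢
  push_cast at hf
  have h1 : ‖(a : ℚ_[p]) / (p : ℚ_[p]) ^ M - (m : ℚ_[p]) / (p : ℚ_[p]) ^ N‖ ≤ 1 := by
    have := (PadicInt.subring p).sub_mem (show _ ∈ PadicInt.subring p from h)
      (show _ ∈ PadicInt.subring p from hf)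
    rw [sub_sub_sub_cancel_left] at this
    exact this
  have h2 : ‖(((a : ℤ) * (p : ℤ) ^ N - m * (p : ℤ) ^ M : ℤ) : ℚ_[p])‖
      ≤ (p : ℝ) ^ (-((M + N : ℕ) : ℤ)) := by
    have : (((a : ℤ) * (p : ℤ) ^ N - m * (p : ℤ) ^ M : ℤ) : ℚ_[p]) =
        ((a : ℚ_[p]) / (p : ℚ_[p]) ^ M - (m : ℚ_[p]) / (p : ℚ_[p]) ^ N)
          * (p : ℚ_[p]) ^ (M + N) := by
      push_cast
      field_simp
      ring
    rw [this, norm_mul, norm_pow, Padic.norm_p, zpow_neg, zpow_natCast, inv_pow]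
    exact mul_le_of_le_one_left (by positivity) h1
  rw [Padic.norm_int_le_pow_iff_dvd] at h2
  have h3 : (a : ℤ) * (p : ℤ) ^ N - m * (p : ℤ) ^ M = 0 := by
    refine Int.eq_zero_of_abs_lt_dvd h2 ?_
    have ha' : (a : ℤ) < (p : ℤ) ^ M := by exact_mod_cast ha
    have hm' : (m : ℤ) < (p : ℤ) ^ N := by exact_mod_cast hm
    have hM : (0 : ℤ) < (p : ℤ) ^ M := by
      have := (Fact.out : p.Prime).pos
      positivity
    have hN : (0 : ℤ) < (p : ℤ) ^ N := by
      have := (Fact.out : p.Prime).pos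
      positivity
    rw [pow_add, abs_lt]
    constructor <;> nlinarith [Int.natCast_nonneg a, Int.natCast_nonneg m]
  rw [div_eq_div_iff (by positivity) (by positivity)]
  exact_mod_cast sub_eq_zero.mp h3

/-- The fractional part is the sum of the terms of negative index of the `p`-adic expansion. -/
theorem padicFract_eq_of_expansion (p : ℕ) [Fact p.Prime] (N : ℕ) (b : ℕ → ℕ)
    (hb : ∀ i, b i < p) (z : ℤ_[p]) (x : ℚ_[p])
    (hx : x = ∑ i ∈ Finset.range N, (b i : ℚ_[p]) * (p : ℚ_[p]) ^ ((i : ℤ) - N) + z) :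
    padicFract p x = ∑ i ∈ Finset.range N, (b i : ℚ) * (p : ℚ) ^ ((i : ℤ) - N) := by
  have hp : (p : ℚ) ≠ 0 := by exact_mod_cast (Fact.out : p.Prime).ne_zero
  have hp0 : (p : ℚ_[p]) ≠ 0 := by exact_mod_cast (Fact.out : p.Prime).ne_zero
  have hlt : ∀ n : ℕ, ∑ i ∈ Finset.range n, b i * p ^ i < p ^ n := by
    intro n
    induction n with
    | zero => simp
    | succ n ih =>
      rw [Finset.sum_range_succ, pow_succ]
      have := Nat.mul_le_mul_right (p ^ n) (Nat.succ_le_of_lt (hb n))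
      rw [Nat.succ_mul] at this
      linarith [mul_comm p (p ^ n)]
  have key := padicFract_unique p x N (∑ i ∈ Finset.range N, b i * p ^ i) (hlt N) ?_
  · rw [key]
    push_cast
    rw [Finset.sum_div]
    refine Finset.sum_congr rfl fun i _ => ?_
    rw [zpow_sub₀ hp, zpow_natCast, zpow_natCast, mul_div_assoc]
  · have : x - ((∑ i ∈ Finset.range N, b i * p ^ i : ℕ) : ℚ_[p]) / (p : ℚ_[p]) ^ N = z := by
      rw [hx]
      push_cast
      rw [Finset.sum_div, add_sub_right_comm, ← Finset.sum_sub_distrib, Finset.sum_eq_zero, zero_add]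
      intro i _
      rw [zpow_sub₀ hp0, zpow_natCast, zpow_natCast, mul_div_assoc, sub_self]
    rw [this]
    exact z.2

theorem padicFract_eq_zero (p : ℕ) [Fact p.Prime] {x : ℚ_[p]} (hx : ‖x‖ ≤ 1) :
    padicFract p x = 0 := by
  have := padicFract_unique p x 0 0 (by simp) (by simpa using hx)
  simpa using this

/-! ### The adeles of `ℚ` and the adelic torus -/

instance factPrimeOfPrimes (p : Nat.Primes) : Fact (p : ℕ).Prime := ⟨p.2⟩

/-- The finite adeles: the restricted product of the fields `ℚ_p` with respect to the `ℤ_p`. -/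
abbrev FinAdele : Type := Πʳ p : Nat.Primes, [ℚ_[(p : ℕ)], PadicInt.subring (p : ℕ)]

/-- The ring `𝔸` of adeles of `ℚ`, with the restricted product topology. -/
abbrev Adele : Type := ℝ × FinAdele

instance padicInt_isOpen_fact :
    Fact (∀ p : Nat.Primes, IsOpen (PadicInt.subring (p : ℕ) : Set ℚ_[(p : ℕ)])) := by
  refine ⟨fun p => ?_⟩
  have h := IsUltrametricDist.isOpen_closedBall (0 : ℚ_[(p : ℕ)]) one_ne_zero
  convert h using 1
  ext x
  exact mem_closedBall_zero_iff.symm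

instance padicInt_compactSpace (p : Nat.Primes) : CompactSpace (PadicInt.subring (p : ℕ)) :=
  inferInstanceAs (CompactSpace ℤ_[(p : ℕ)])

theorem finite_not_padicInt (x : FinAdele) : {p : Nat.Primes | ¬ ‖x p‖ ≤ 1}.Finite :=
  x.eventually

/-- A rational number is a `p`-adic integer for all but finitely many primes `p`. -/
theorem rat_eventually_padicInt (q : ℚ) :
    ∀ᶠ p : Nat.Primes in Filter.cofinite, (q : ℚ_[(p : ℕ)]) ∈ PadicInt.subring (p : ℕ) := by
  have hfin : {p : Nat.Primes | (p : ℕ) ∣ q.den}.Finite := by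
    have h := (Nat.divisors q.den).finite_toSet.preimage
      (f := fun p : Nat.Primes => (p : ℕ)) Subtype.val_injective.injOn
    refine h.subset fun p hp => ?_
    simpa [q.den_nz] using hp
  refine hfin.subset fun p hp => ?_
  by_contra hd
  exact hp (Padic.norm_rat_le_one hd)

/-- The diagonal embedding `ℚ → 𝔸`. -/
noncomputable def adeleDiagonal : ℚ →+ Adele where
  toFun q := ((q : ℝ), ⟨fun p => (q : ℚ_[(p : ℕ)]), rat_eventually_padicInt q⟩)
  map_zero' := by
    refine Prod.ext (by simp) (RestrictedProduct.ext _ _ fun p => ?_)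
    exact Rat.cast_zero
  map_add' x y := by
    refine Prod.ext (by simp) (RestrictedProduct.ext _ _ fun p => ?_)
    exact Rat.cast_add x y

/-- The adelic torus `𝔸 / ℚ`, with the quotient topology. -/
abbrev AdelicTorus : Type := Adele ⧸ adeleDiagonal.range

/-- The measurable sets of the adelic torus are the Borel sets. -/
noncomputable instance adelicTorusMeasurableSpace : MeasurableSpace AdelicTorus := borel AdelicTorus

instance adelicTorusBorelSpace : BorelSpace AdelicTorus := ⟨rfl⟩

theorem exists_rat_sub_integral (x : FinAdele) :
    ∃ r : ℚ, ∀ p : Nat.Primes, ‖x p - (r : ℚ_[(p : ℕ)])‖ ≤ 1 := by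
  classical
  set S := (finite_not_padicInt x).toFinset with hS
  refine ⟨∑ q ∈ S, padicFract q (x q), fun p => ?_⟩
  have hoff : ∀ q : Nat.Primes, q ≠ p → ‖((padicFract q (x q) : ℚ) : ℚ_[(p : ℕ)])‖ ≤ 1 := by
    intro q hqp
    obtain ⟨⟨N, m, -, h⟩, -⟩ := padicFract_spec q (x q)
    rw [h]
    push_cast
    have hq : ‖((q : ℕ) : ℚ_[(p : ℕ)])‖ = 1 := by
      rw [Padic.norm_natCast_eq_one_iff]
      exact (Nat.coprime_primes p.2 q.2).mpr fun h => hqp (Subtype.ext h.symm)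
    rw [norm_div, norm_pow, hq, one_pow, div_one]
    simpa using Padic.norm_int_le_one (p := (p : ℕ)) (m : ℤ)
  have hsum : ∀ T : Finset Nat.Primes, (∀ q ∈ T, q ≠ p) →
      ‖((∑ q ∈ T, padicFract q (x q) : ℚ) : ℚ_[(p : ℕ)])‖ ≤ 1 := by
    intro T hT
    have : ((∑ q ∈ T, padicFract q (x q) : ℚ) : ℚ_[(p : ℕ)]) ∈ PadicInt.subring (p : ℕ) := by
      push_cast
      exact Subring.sum_mem _ fun q hq => hoff q (hT q hq)
    exact this
  by_cases hp : p ∈ S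
  · rw [← Finset.add_sum_erase S _ hp]
    push_cast
    rw [← sub_sub]
    have h := hsum (S.erase p) fun q hq => Finset.ne_of_mem_erase hq
    push_cast at h
    exact (PadicInt.subring (p : ℕ)).sub_mem (padicFract_spec p (x p)).2 h
  · have hx : ‖x p‖ ≤ 1 := by
      by_contra hx
      exact hp (by simpa [hS] using hx)
    exact (PadicInt.subring (p : ℕ)).sub_mem hx
      (hsum S fun q hq hqp => hp (hqp ▸ hq))

/-- The adelic torus is compact, being the image of `[0, 1] × ∏ ℤ_p`. -/
instance adelicTorusCompactSpace : CompactSpace AdelicTorus := by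
  let f : ℝ × (∀ p : Nat.Primes, PadicInt.subring (p : ℕ)) → AdelicTorus := fun y =>
    QuotientAddGroup.mk ((y.1, RestrictedProduct.structureMap _ _ _ y.2) : Adele)
  have hf : Continuous f := continuous_quotient_mk'.comp
    (continuous_fst.prodMk (RestrictedProduct.isEmbedding_structureMap.continuous.comp
      continuous_snd))
  have hK : IsCompact (f '' (Icc 0 1 ×ˢ univ)) := (isCompact_Icc.prod isCompact_univ).image hf
  refine ⟨?_⟩
  convert hK
  refine (eq_univ_of_forall fun y => ?_).symm
  obtain ⟨a, rfl⟩ := QuotientAddGroup.mk_surjective y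
  obtain ⟨r, hr⟩ := exists_rat_sub_integral a.2
  set n : ℤ := ⌊a.1 - r⌋ with hn
  have hmem : ∀ p : Nat.Primes,
      a.2 p - ((r + n : ℚ) : ℚ_[(p : ℕ)]) ∈ PadicInt.subring (p : ℕ) := by
    intro p
    push_cast
    rw [← sub_sub]
    exact (PadicInt.subring (p : ℕ)).sub_mem (hr p) (Padic.norm_int_le_one n)
  refine ⟨(a.1 - ((r + n : ℚ) : ℝ), fun p => ⟨_, hmem p⟩), ⟨⟨?_, ?_⟩, mem_univ _⟩, ?_⟩
  · push_cast
    linarith [Int.floor_le (a.1 - r)]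
  · push_cast
    linarith [Int.lt_floor_add_one (a.1 - r)]
  · refine (QuotientAddGroup.eq.mpr ⟨r + n, ?_⟩)
    refine Prod.ext ?_ (RestrictedProduct.ext _ _ fun p => ?_)
    · change ((r + n : ℚ) : ℝ) = -(a.1 - ((r + n : ℚ) : ℝ)) + a.1
      ring
    · change ((r + n : ℚ) : ℚ_[(p : ℕ)]) = -(a.2 p - ((r + n : ℚ) : ℚ_[(p : ℕ)])) + a.2 p
      ring

/-- The Haar probability measure on the adelic torus: the Haar measure that gives the whole
compact group measure `1`. -/
noncomputable def adelicHaar : Measure AdelicTorus :=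
  Measure.addHaarMeasure (⊤ : PositiveCompacts AdelicTorus)

/-! Modulo 1, the volumes are the eigenvalues of the rotation, and the eigenvalues are the values of
characters at `α`. If the discrepancies of `A` are bounded, their limsup `g` satisfies `g x = χ_A x
- |A| + g (x + α)` almost everywhere (`IsBoundedRemainderSet.exists_transfer`). Since `χ_A` takes
integer values, `g` mod 1 is an eigenfunction, written additively, with eigenvalue `|A|` mod 1. It
has a nonzero Fourier coefficient against some `ψ ∈ Γ`, which forces the eigenvalue to be `ψ α`
(`exists_character_of_eigenfunction`). Conversely, for a lift `v ≥ 0` of `ψ α` and the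
representative `g` of `ψ` in `[0, 1)`, the function `v + g - g ∘ T_α` is the counting function of a
multiset of volume `v` whose discrepancies telescope (`mem_boundedRemainderVolumes_of_character`).
Only a point-separating group of characters is needed, not the full dual. On `𝔸 / ℚ` the characters
`torusCharacter γ` form one (`eq_zero_of_forall_torusCharacters`). -/

/-! ### Bounded remainder volumes of rotations of compact groups -/

/-! ### Counting functions of multisets -/

section Multiset

variable {G : Type*}

/-- A function with values in `{0, …, k}` is the counting function of its superlevel sets. -/
theorem multisetIndicator_superlevel {k : ℕ} (F : G → ℝ)
    (hF : ∀ x, ∃ m : ℕ, m ≤ k ∧ F x = m) (x : G) :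
    multisetIndicator (fun i : Fin k => {x | ((i : ℕ) : ℝ) < F x}) x = F x := by
  obtain ⟨m, hm, hx⟩ := hF x
  simp only [multisetIndicator, indicator_apply, mem_ofPred_eq, hx, Nat.cast_lt]
  rw [Fin.sum_univ_eq_sum_range (fun i => if i < m then (1 : ℝ) else 0) k, Finset.sum_boole]
  congr 1
  rw [show (Finset.range k).filter (· < m) = Finset.range m by
    ext i
    simp only [Finset.mem_filter, Finset.mem_range]
    omega, Finset.card_range]

theorem exists_int_multisetIndicator {k : ℕ} (A : Fin k → Set G) (x : G) :
    ∃ n : ℤ, multisetIndicator A x = n := by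
  classical
  refine ⟨∑ i, if x ∈ A i then 1 else 0, ?_⟩
  simp [multisetIndicator, indicator_apply]

variable [MeasurableSpace G]

theorem measurable_multisetIndicator {k : ℕ} {A : Fin k → Set G}
    (hA : ∀ i, MeasurableSet (A i)) : Measurable (multisetIndicator A) :=
  Finset.measurable_fun_sum _ fun i _ => measurable_const.indicator (hA i)

theorem multisetVolume_eq_integral (μ : Measure G) [IsFiniteMeasure μ] {k : ℕ}
    {A : Fin k → Set G} (hA : ∀ i, MeasurableSet (A i)) :
    multisetVolume μ A = ∫ x, multisetIndicator A x ∂μ := by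
  unfold multisetVolume multisetIndicator
  rw [integral_finsetSum _ fun i _ => (integrable_const _).indicator (hA i)]
  simp [integral_indicator_const, hA]

end Multiset

/-! ### Density of the span of a group of characters -/

section Characters

variable {G : Type*} [AddCommGroup G] [TopologicalSpace G]

/-- The continuous complex function attached to a continuous character. -/
noncomputable def characterFun (ψ : G →ₜ+ UnitAddCircle) : C(G, ℂ) where
  toFun x := (AddCircle.toCircle (ψ x) : Circle)
  continuous_toFun := continuous_induced_dom.comp
    (AddCircle.continuous_toCircle.comp (map_continuous ψ))

theorem characterFun_apply (ψ : G →ₜ+ UnitAddCircle) (x : G) :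
    characterFun ψ x = (AddCircle.toCircle (ψ x) : Circle) := rfl

theorem conj_characterFun (ψ : G →ₜ+ UnitAddCircle) (x : G) :
    (starRingEnd ℂ) (characterFun ψ x) = (AddCircle.toCircle (-ψ x) : Circle) := by
  rw [characterFun_apply, ← Circle.coe_inv_eq_conj, ← AddCircle.toCircle_neg]

/-- The star subalgebra generated by a subgroup of the continuous characters. -/
noncomputable def characterSubalgebra (Γ : AddSubgroup (G →ₜ+ UnitAddCircle)) : StarSubalgebra ℂ C(G, ℂ) where
  toSubalgebra := Algebra.adjoin ℂ (characterFun '' Γ)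
  star_mem' := by
    change Algebra.adjoin ℂ (characterFun '' (Γ : Set (G →ₜ+ UnitAddCircle))) ≤
      star (Algebra.adjoin ℂ (characterFun '' (Γ : Set (G →ₜ+ UnitAddCircle))))
    refine Algebra.adjoin_le ?_
    rintro - ⟨ψ, hψ, rfl⟩
    exact Algebra.subset_adjoin ⟨-ψ, Γ.neg_mem hψ, ContinuousMap.ext fun x => (conj_characterFun ψ x).symm⟩

/-- Products of characters from `Γ` are again characters from `Γ`, so linear combinations already
form an algebra. -/
theorem characterSubalgebra_coe (Γ : AddSubgroup (G →ₜ+ UnitAddCircle)) :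
    Subalgebra.toSubmodule (characterSubalgebra Γ).toSubalgebra =
      Submodule.span ℂ (characterFun '' Γ) := by
  apply Algebra.adjoin_eq_span_of_subset
  refine Subset.trans ?_ Submodule.subset_span
  intro f hf
  refine Submonoid.closure_induction (fun _ => id) ⟨0, Γ.zero_mem, ?_⟩ ?_ hf
  · ext x
    exact congrArg Subtype.val (AddCircle.toCircle_zero (T := 1))
  · rintro - - - - ⟨ψ, hψ, rfl⟩ ⟨χ, hχ, rfl⟩
    refine ⟨ψ + χ, Γ.add_mem hψ hχ, ?_⟩
    ext x
    exact congrArg Subtype.val (AddCircle.toCircle_add (ψ x) (χ x))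

variable [CompactSpace G]

/-- Stone–Weierstrass: the span is a point-separating star subalgebra. -/
theorem span_characterFun_closure_eq_top (Γ : AddSubgroup (G →ₜ+ UnitAddCircle))
    (hΓ : ∀ x : G, (∀ ψ ∈ Γ, ψ x = 0) → x = 0) :
    (Submodule.span ℂ (characterFun '' (Γ : Set (G →ₜ+ UnitAddCircle)))).topologicalClosure = ⊤ := by
  rw [← characterSubalgebra_coe]
  refine congrArg (Subalgebra.toSubmodule <| StarSubalgebra.toSubalgebra ·)
    (ContinuousMap.starSubalgebra_topologicalClosure_eq_top_of_separatesPoints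
      (characterSubalgebra Γ) ?_)
  intro x y hxy
  obtain ⟨ψ, hψ, hne⟩ : ∃ ψ ∈ Γ, ψ (x - y) ≠ 0 := by
    by_contra! hall
    exact hxy (sub_eq_zero.mp (hΓ _ hall))
  refine ⟨_, ⟨characterFun ψ, Algebra.subset_adjoin ⟨ψ, hψ, rfl⟩, rfl⟩, fun heq => hne ?_⟩
  rw [map_sub, sub_eq_zero]
  exact AddCircle.injective_toCircle one_ne_zero (Subtype.ext heq)

end Characters

/-! ### Coboundaries and eigenfunctions of rotations -/

section CompactGroup

variable {G : Type*} [AddCommGroup G]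

theorem iterate_rotationBy (α : G) (n : ℕ) (x : G) : (rotationBy α)^[n] x = x + n • α := by
  induction n with
  | zero => simp
  | succ n ih => rw [Function.iterate_succ_apply', ih, rotationBy, succ_nsmul, add_assoc]

variable [MeasurableSpace G] [TopologicalSpace G] [IsTopologicalAddGroup G] [BorelSpace G]

/-- Every nonnegative lift of the value at `α` of a continuous character is the volume of a bounded
remainder set. -/
theorem mem_boundedRemainderVolumes_of_character (μ : Measure G) [IsProbabilityMeasure μ]
    [μ.IsAddRightInvariant] (α : G) (ψ : G →ₜ+ UnitAddCircle) {v : ℝ} (hv : 0 ≤ v)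
    (h : (v : UnitAddCircle) = ψ α) : v ∈ boundedRemainderVolumes μ α := by
  set g : G → ℝ := fun x => (AddCircle.measurableEquivIco 1 0 (ψ x) : ℝ) with hg
  have hgm : Measurable g := measurable_subtype_coe.comp
    ((AddCircle.measurableEquivIco 1 0).measurable.comp (map_continuous ψ).measurable)
  have hg0 : ∀ x, 0 ≤ g x := fun x => (AddCircle.equivIco 1 0 (ψ x)).2.1
  have hg1 : ∀ x, g x < 1 := fun x =>
    (AddCircle.equivIco 1 0 (ψ x)).2.2.trans_eq (zero_add 1)
  have hgψ : ∀ x, (g x : UnitAddCircle) = ψ x := fun x => AddCircle.coe_equivIco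
  have hgi : Integrable g μ := Integrable.of_bound hgm.aestronglyMeasurable 1
    (Filter.Eventually.of_forall fun x => by
      rw [Real.norm_of_nonneg (hg0 x)]; exact (hg1 x).le)
  set F : G → ℝ := fun x => v + g x - g (x + α) with hF
  have hFm : Measurable F := by
    have := hgm.comp (measurable_add_const α)
    exact (hgm.const_add v).sub this
  -- `F` vanishes mod 1 and lies strictly between `-1` and `v + 1`, so its values are integers from
  -- `0` to `⌊v⌋₊ + 1`.
  set k := ⌊v⌋₊ + 1 with hk
  have hFk : ∀ x, ∃ m : ℕ, m ≤ k ∧ F x = m := by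
    intro x
    have hz : (F x : UnitAddCircle) = 0 := by
      rw [hF, AddCircle.coe_sub, AddCircle.coe_add, hgψ, hgψ, h, map_add]
      abel
    obtain ⟨n, hn⟩ := (AddCircle.coe_eq_zero_iff (1 : ℝ)).mp hz
    rw [zsmul_eq_mul, mul_one] at hn
    have h0 : (-1 : ℝ) < n := by
      rw [hn]
      linarith [hg0 x, hg1 (x + α)]
    have h1 : (n : ℝ) < v + 1 := by
      rw [hn]
      linarith [hg1 x, hg0 (x + α)]
    have h0' : 0 ≤ n := by
      have : (-1 : ℤ) < n := by exact_mod_cast h0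
      omega
    lift n to ℕ using h0'
    rw [Int.cast_natCast] at hn h1
    refine ⟨n, ?_, hn.symm⟩
    have := h1.trans (add_lt_add_left (Nat.lt_floor_add_one v) 1)
    have : n < ⌊v⌋₊ + 1 + 1 := by exact_mod_cast this
    omega
  set A : Fin k → Set G := fun i => {x | ((i : ℕ) : ℝ) < F x} with hA
  have hAm : ∀ i, MeasurableSet (A i) := fun i => measurableSet_lt measurable_const hFm
  have hAF : ∀ x, multisetIndicator A x = F x := multisetIndicator_superlevel F hFk
  have hvol : multisetVolume μ A = v := by
    rw [multisetVolume_eq_integral μ hAm]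
    simp_rw [hAF, hF]
    rw [integral_sub (Integrable.fun_add (integrable_const v) hgi) (hgi.comp_add_right α),
      integral_add (integrable_const v) hgi, integral_add_right_eq_self]
    simp
  refine ⟨k, A, ⟨hAm, 1, one_pos, Filter.Eventually.of_forall fun x N => ?_⟩, hvol⟩
  have hsum : ∑ n ∈ Finset.range N, multisetIndicator A ((rotationBy α)^[n] x)
      - N * multisetVolume μ A = g x - g (x + N • α) := by
    rw [hvol]
    induction N with
    | zero => simp
    | succ N ih =>
      rw [Finset.sum_range_succ, hAF, iterate_rotationBy, hF, succ_nsmul, ← add_assoc]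
      push_cast
      linear_combination ih
  rw [hsum, abs_le]
  constructor <;> linarith [hg0 x, hg1 x, hg0 (x + N • α), hg1 (x + N • α)]

/-- The discrepancies of a bounded remainder set are those of a measurable coboundary. -/
theorem IsBoundedRemainderSet.exists_transfer {μ : Measure G} [μ.IsAddRightInvariant] {α : G}
    {k : ℕ} {A : Fin k → Set G} (h : IsBoundedRemainderSet μ α A) :
    ∃ g : G → ℝ, Measurable g ∧
      ∀ᵐ x ∂μ, g x = multisetIndicator A x - multisetVolume μ A + g (x + α) := by
  obtain ⟨hA, C, -, hC⟩ := h
  set S : ℕ → G → ℝ := fun N x =>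
    ∑ n ∈ Finset.range N, multisetIndicator A (x + n • α) - N * multisetVolume μ A with hS
  simp_rw [iterate_rotationBy] at hC
  have hSm : ∀ N, Measurable (S N) := fun N =>
    (Finset.measurable_fun_sum _ fun n _ =>
      (measurable_multisetIndicator hA).comp (measurable_add_const _)).sub_const _
  -- A limsup is measurable and unchanged by an index shift; no convergence is needed.
  refine ⟨fun x => Filter.limsup (fun N => S N x) Filter.atTop, Measurable.limsup hSm, ?_⟩
  have hC' : ∀ᵐ x ∂μ, ∀ N, |S N (x + α)| ≤ C :=
    (measurePreserving_add_right μ α).quasiMeasurePreserving.ae hC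
  filter_upwards [hC'] with x hx
  have hstep : ∀ N, S (N + 1) x =
      (multisetIndicator A x - multisetVolume μ A) + S N (x + α) := by
    intro N
    simp only [hS]
    rw [Finset.sum_range_succ', zero_nsmul, add_zero]
    simp_rw [succ_nsmul', ← add_assoc]
    push_cast
    ring
  rw [← Filter.limsup_nat_add (fun N => S N x) 1]
  simp_rw [hstep]
  refine limsup_const_add Filter.atTop (fun N => S N (x + α)) _ ?_ ?_
  · exact Filter.isBoundedUnder_of ⟨C, fun N => (abs_le.mp (hx N)).2⟩
  · exact (Filter.isBoundedUnder_of ⟨-C, fun N => (abs_le.mp (hx N)).1⟩ :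
      Filter.IsBoundedUnder (· ≥ ·) _ _).isCoboundedUnder_le

variable [CompactSpace G]

/-- The eigenvalue of a measurable eigenfunction of absolute value one of a rotation is the value of
a character. Both the eigenfunction and the eigenvalue are written additively. -/
theorem exists_character_of_eigenfunction [T2Space G] (μ : Measure G) [IsProbabilityMeasure μ]
    [μ.IsAddRightInvariant] [μ.WeaklyRegular] (Γ : AddSubgroup (G →ₜ+ UnitAddCircle))
    (hΓ : ∀ x : G, (∀ ψ ∈ Γ, ψ x = 0) → x = 0) (α : G) (θ : UnitAddCircle) (u : G → UnitAddCircle)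
    (hu : Measurable u) (h : ∀ᵐ x ∂μ, u (x + α) = θ + u x) : ∃ ψ ∈ Γ, θ = ψ α := by
  by_contra! hne
  set U : G → ℂ := fun x => (AddCircle.toCircle (u x) : Circle) with hU
  have hUm : Measurable U :=
    (continuous_induced_dom.comp AddCircle.continuous_toCircle).measurable.comp hu
  have hL : MemLp U 2 μ := MemLp.of_bound hUm.aestronglyMeasurable 1
    (Filter.Eventually.of_forall fun x => (Circle.norm_coe _).le)
  have horth : ∀ ψ ∈ Γ, ∫ x, U x * (starRingEnd ℂ) (characterFun ψ x) ∂μ = 0 := by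
    intro ψ hψ
    set I := ∫ x, U x * (starRingEnd ℂ) (characterFun ψ x) ∂μ with hI
    -- Translating the integration variable by `α` multiplies the coefficient by the circle element
    -- of `θ - ψ α`, which is not 1.
    have hc : I = (AddCircle.toCircle (θ - ψ α) : ℂ) * I := by
      rw [hI]
      conv_lhs => rw [← integral_add_right_eq_self _ α]
      rw [← integral_const_mul]
      refine integral_congr_ae ?_
      filter_upwards [h] with x hx
      rw [conj_characterFun, conj_characterFun]
      have key : AddCircle.toCircle (u (x + α)) * AddCircle.toCircle (-ψ (x + α)) =
          AddCircle.toCircle (θ - ψ α) *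
            (AddCircle.toCircle (u x) * AddCircle.toCircle (-ψ x)) := by
        rw [← AddCircle.toCircle_add, ← AddCircle.toCircle_add, ← AddCircle.toCircle_add, hx,
          map_add]
        congr 1
        abel
      exact congrArg (fun z : Circle => (z : ℂ)) key
    by_contra hI0
    have h1 : (AddCircle.toCircle (θ - ψ α) : ℂ) = 1 :=
      mul_right_cancel₀ hI0 (by rw [one_mul]; exact hc.symm)
    have h2 : AddCircle.toCircle (θ - ψ α) = AddCircle.toCircle (0 : UnitAddCircle) := by
      rw [AddCircle.toCircle_zero]
      exact Subtype.ext h1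
    exact hne ψ hψ (sub_eq_zero.mp (AddCircle.injective_toCircle one_ne_zero h2))
  -- Uniform density in `C(G, ℂ)` passes to density in `L²`, so `U`, orthogonal to every character
  -- in `Γ`, vanishes almost everywhere, although `|U| = 1`.
  have hdense := (ContinuousMap.toLp_denseRange (p := 2) ℂ μ ℂ
    (by simp)).topologicalClosure_map_submodule (span_characterFun_closure_eq_top Γ hΓ)
  rw [Submodule.topologicalClosure_eq_top_iff] at hdense
  have hmem : hL.toLp ∈ (Submodule.map (ContinuousMap.toLp (E := ℂ) 2 μ ℂ : C(G, ℂ) →ₗ[ℂ] Lp ℂ 2 μ)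
      (Submodule.span ℂ (characterFun '' (Γ : Set (G →ₜ+ UnitAddCircle)))))ᗮ := by
    rw [Submodule.map_span, Submodule.mem_orthogonal]
    intro f hf
    induction hf using Submodule.span_induction with
    | mem f hf =>
      obtain ⟨-, ⟨ψ, hψ, rfl⟩, rfl⟩ := hf
      rw [L2.inner_def, ← horth ψ hψ]
      refine integral_congr_ae ?_
      filter_upwards [hL.coeFn_toLp, ContinuousMap.coeFn_toLp (p := 2) (𝕜 := ℂ) μ (characterFun ψ)]
        with x hx hx'
      rw [hx]
      erw [hx']
      rfl
    | zero => exact inner_zero_left _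
    | add f g _ _ hf hg => rw [inner_add_left, hf, hg, add_zero]
    | smul c f _ hf => rw [inner_smul_left, hf, mul_zero]
  rw [hdense, Submodule.mem_bot] at hmem
  have hzero : ∀ᵐ x ∂μ, U x = 0 := by
    have h0 := hL.coeFn_toLp
    rw [hmem] at h0
    filter_upwards [h0, Lp.coeFn_zero ℂ 2 μ] with x hx hx'
    rw [← hx, hx']
    rfl
  obtain ⟨x, hx⟩ := hzero.exists
  exact Circle.coe_ne_zero _ hx

/-- For a point-separating group `Γ` of continuous characters of a compact group, the volumes of the
bounded remainder sets of the rotation by `α` are the nonnegative lifts of the values `ψ α` with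
`ψ ∈ Γ`. -/
theorem mem_boundedRemainderVolumes_iff [T2Space G] (μ : Measure G) [IsProbabilityMeasure μ]
    [μ.IsAddRightInvariant] [μ.WeaklyRegular] (Γ : AddSubgroup (G →ₜ+ UnitAddCircle))
    (hΓ : ∀ x : G, (∀ ψ ∈ Γ, ψ x = 0) → x = 0) (α : G) (v : ℝ) :
    v ∈ boundedRemainderVolumes μ α ↔ 0 ≤ v ∧ ∃ ψ ∈ Γ, (v : UnitAddCircle) = ψ α := by
  constructor
  · rintro ⟨k, A, hA, rfl⟩
    refine ⟨Finset.sum_nonneg fun i _ => measureReal_nonneg, ?_⟩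
    obtain ⟨g, hgm, hg⟩ := hA.exists_transfer
    refine exists_character_of_eigenfunction μ Γ hΓ α _
      (fun x => (g x : UnitAddCircle)) (AddCircle.measurable_mk'.comp hgm) ?_
    filter_upwards [hg] with x hx
    obtain ⟨n, hn⟩ := exists_int_multisetIndicator A x
    have hn0 : ((n : ℝ) : UnitAddCircle) = 0 :=
      (AddCircle.coe_eq_zero_iff (1 : ℝ)).mpr ⟨n, by simp⟩
    rw [hx, hn, AddCircle.coe_add, AddCircle.coe_sub, hn0]
    abel
  · rintro ⟨hv, ψ, -, h⟩
    exact mem_boundedRemainderVolumes_of_character μ α ψ hv h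

end CompactGroup

/-! ### The characters of the adelic torus -/

/-- A rational number that is a `p`-adic integer for all primes `p` is an integer. -/
theorem exists_int_of_forall_padic_norm_le_one {q : ℚ}
    (h : ∀ p : Nat.Primes, ‖(q : ℚ_[(p : ℕ)])‖ ≤ 1) : ∃ n : ℤ, q = n := by
  refine ⟨q.num, (Rat.coe_int_num_of_den_eq_one ?_).symm⟩
  by_contra hd
  obtain ⟨p, hp, hpd⟩ := Nat.exists_prime_and_dvd hd
  have : Fact p.Prime := ⟨hp⟩
  have hq : (q : ℚ_[p]) * (q.den : ℚ_[p]) = (q.num : ℚ_[p]) := by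
    exact_mod_cast congrArg (Rat.cast (K := ℚ_[p])) (Rat.mul_den_eq_num q)
  have hden : ‖(q.den : ℚ_[p])‖ < 1 := Padic.norm_natCast_lt_one_iff.mpr hpd
  have hnum : ‖(q.num : ℚ_[p])‖ < 1 := by
    rw [← hq, norm_mul]
    exact (mul_le_of_le_one_left (norm_nonneg _) (h ⟨p, hp⟩)).trans_lt hden
  have hpn := Int.natCast_dvd.mp (Padic.norm_intCast_lt_one_iff.mp hnum)
  exact Nat.not_coprime_of_dvd_of_dvd hp.one_lt hpn hpd q.reduced

/-- The sum of the `p`-adic fractional parts of a finite adele. -/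
noncomputable def adeleFract (x : FinAdele) : ℚ := ∑ᶠ p : Nat.Primes, padicFract (p : ℕ) (x p)

theorem finite_support_padicFract (x : FinAdele) :
    (Function.support fun p : Nat.Primes => padicFract (p : ℕ) (x p)).Finite :=
  (finite_not_padicInt x).subset fun p hp hx => hp (padicFract_eq_zero (p : ℕ) hx)

/-- The denominator is a power of `q`, hence a unit at `p`. -/
theorem padicFract_norm_le_one_of_ne {p q : Nat.Primes} (h : q ≠ p) (x : ℚ_[(q : ℕ)]) :
    ‖((padicFract q x : ℚ) : ℚ_[(p : ℕ)])‖ ≤ 1 := by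
  obtain ⟨⟨N, m, -, hx⟩, -⟩ := padicFract_spec q x
  have hq : ‖((q : ℕ) : ℚ_[(p : ℕ)])‖ = 1 := by
    rw [Padic.norm_natCast_eq_one_iff]
    exact (Nat.coprime_primes p.2 q.2).mpr fun h' => h (Subtype.ext h'.symm)
  rw [hx]
  push_cast
  rw [norm_div, norm_pow, hq, one_pow, div_one]
  simpa using Padic.norm_int_le_one (p := (p : ℕ)) (m : ℤ)

/-- Only the summand at `p` can fail to be integral at `p`, and it differs from `x p` by a `p`-adic
integer. -/
theorem norm_sub_adeleFract_le_one (x : FinAdele) (p : Nat.Primes) :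
    ‖x p - (adeleFract x : ℚ_[(p : ℕ)])‖ ≤ 1 := by
  classical
  set S := insert p (finite_support_padicFract x).toFinset
  have hsum : adeleFract x = padicFract p (x p) + ∑ q ∈ S.erase p, padicFract q (x q) := by
    rw [Finset.add_sum_erase S (fun q : Nat.Primes => padicFract q (x q))
      (Finset.mem_insert_self _ _)]
    exact finsum_eq_sum_of_support_subset _ fun q hq => by simp [S]; exact Or.inr hq
  rw [hsum]
  push_cast
  rw [← sub_sub]
  exact (PadicInt.subring (p : ℕ)).sub_mem (padicFract_spec p (x p)).2
    (Subring.sum_mem _ fun q hq => padicFract_norm_le_one_of_ne (Finset.ne_of_mem_erase hq) _)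

/-- Modulo `ℤ`, the sum of the fractional parts is the rational number `r` for which `x - r` is
integral. -/
theorem coe_adeleFract_eq {x : FinAdele} {r : ℚ}
    (h : ∀ p : Nat.Primes, ‖x p - (r : ℚ_[(p : ℕ)])‖ ≤ 1) :
    (((adeleFract x : ℚ) : ℝ) : UnitAddCircle) = ((r : ℝ) : UnitAddCircle) := by
  obtain ⟨n, hn⟩ := exists_int_of_forall_padic_norm_le_one (q := adeleFract x - r) fun p => by
    have := (PadicInt.subring (p : ℕ)).sub_mem (h p) (norm_sub_adeleFract_le_one x p)
    rw [sub_sub_sub_cancel_left] at this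
    push_cast
    exact this
  rw [← sub_eq_zero, ← AddCircle.coe_sub, AddCircle.coe_eq_zero_iff]
  refine ⟨n, ?_⟩
  rw [zsmul_eq_mul, mul_one]
  exact_mod_cast hn.symm

/-- Carries make fractional parts additive only modulo `ℤ`; there, any rational approximation of `x
+ y` may replace its `adeleFract`. -/
theorem coe_adeleFract_add (x y : FinAdele) :
    (((adeleFract (x + y) : ℚ) : ℝ) : UnitAddCircle) =
      ((adeleFract x : ℝ) : UnitAddCircle) + ((adeleFract y : ℝ) : UnitAddCircle) := by
  rw [coe_adeleFract_eq (r := adeleFract x + adeleFract y), ← AddCircle.coe_add, Rat.cast_add]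
  intro p
  have := (PadicInt.subring (p : ℕ)).add_mem (norm_sub_adeleFract_le_one x p)
    (norm_sub_adeleFract_le_one y p)
  rw [sub_add_sub_comm] at this
  rw [Rat.cast_add]
  exact this

/-- The standard character `x ↦ -x_∞ + ∑ {x_p}_p` of the adeles. -/
noncomputable def adeleCharacter : Adele →+ UnitAddCircle where
  toFun x := ((-x.1 + adeleFract x.2 : ℝ) : UnitAddCircle)
  map_zero' := by
    have h := coe_adeleFract_eq (x := 0) (r := 0) fun p => by simp
    rw [AddCircle.coe_add]
    erw [h]
    simp
  map_add' x y := by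
    rw [AddCircle.coe_add, AddCircle.coe_add, AddCircle.coe_add, Prod.fst_add, Prod.snd_add,
      coe_adeleFract_add, neg_add, AddCircle.coe_add]
    abel

theorem adeleCharacter_apply (x : Adele) :
    adeleCharacter x = ((-x.1 + adeleFract x.2 : ℝ) : UnitAddCircle) := rfl

theorem adeleCharacter_eq {x : Adele} {r : ℚ}
    (h : ∀ p : Nat.Primes, ‖x.2 p - (r : ℚ_[(p : ℕ)])‖ ≤ 1) :
    adeleCharacter x = ((-x.1 + r : ℝ) : UnitAddCircle) := by
  rw [adeleCharacter_apply, AddCircle.coe_add, coe_adeleFract_eq h, ← AddCircle.coe_add]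

/-- The rational `q` approximates its own finite part exactly, and the minus sign at the real place
cancels it. -/
theorem adeleCharacter_adeleDiagonal (q : ℚ) : adeleCharacter (adeleDiagonal q) = 0 := by
  rw [adeleCharacter_eq (r := q) fun p => ?_]
  · rw [show (adeleDiagonal q).1 = (q : ℝ) from rfl, neg_add_cancel, AddCircle.coe_zero]
  · rw [show (adeleDiagonal q).2 p = (q : ℚ_[(p : ℕ)]) from rfl, sub_self, norm_zero]
    exact zero_le_one

/-- On the open set of adeles with integral finite part the character is just `-x_∞` mod 1. -/
theorem continuous_adeleCharacter : Continuous adeleCharacter := by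
  refine continuous_of_continuousAt_zero adeleCharacter ?_
  have hopen : IsOpen {x : FinAdele | ∀ p : Nat.Primes, x p ∈ PadicInt.subring (p : ℕ)} :=
    RestrictedProduct.isOpen_forall_mem
      (Fact.out : ∀ p : Nat.Primes, IsOpen (PadicInt.subring (p : ℕ) : Set ℚ_[(p : ℕ)]))
  have hnhds : ∀ᶠ x : Adele in nhds 0, ∀ p : Nat.Primes, x.2 p ∈ PadicInt.subring (p : ℕ) :=
    (hopen.preimage continuous_snd).mem_nhds fun p => (PadicInt.subring (p : ℕ)).zero_mem
  have hcont : Continuous fun x : Adele => ((-x.1 : ℝ) : UnitAddCircle) :=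
    (AddCircle.continuous_mk' 1).comp continuous_fst.neg
  refine hcont.continuousAt.congr (hnhds.mono fun x hx => ?_)
  rw [adeleCharacter_eq (r := 0) fun p => by simpa using hx p]
  simp

theorem adeleDiagonal_mul (q r : ℚ) :
    adeleDiagonal (q * r) = adeleDiagonal q * adeleDiagonal r := by
  refine Prod.ext (Rat.cast_mul q r) (RestrictedProduct.ext _ _ fun p => ?_)
  exact Rat.cast_mul q r

/-- The character `x ↦ -γ x_∞ + ∑ {γ x_p}_p` of the adelic torus. -/
noncomputable def torusCharacter (γ : ℚ) : AdelicTorus →ₜ+ UnitAddCircle where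
  toAddMonoidHom := QuotientAddGroup.lift _
    (adeleCharacter.comp (AddMonoidHom.mulLeft (adeleDiagonal γ))) (by
      rintro - ⟨q, rfl⟩
      rw [AddMonoidHom.mem_ker, AddMonoidHom.comp_apply, AddMonoidHom.coe_mulLeft,
        ← adeleDiagonal_mul, adeleCharacter_adeleDiagonal])
  continuous_toFun := (continuous_adeleCharacter.comp (continuous_const_mul _)).quotient_lift _

theorem torusCharacter_mk (γ : ℚ) (x : Adele) :
    torusCharacter γ (QuotientAddGroup.mk x) = adeleCharacter (adeleDiagonal γ * x) := rfl

/-- The group of the characters `torusCharacter γ` with `γ ∈ ℚ`. -/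
noncomputable def torusCharacters : AddSubgroup (AdelicTorus →ₜ+ UnitAddCircle) where
  carrier := range torusCharacter
  zero_mem' := ⟨0, by
    ext x
    obtain ⟨a, rfl⟩ := QuotientAddGroup.mk_surjective x
    rw [torusCharacter_mk, map_zero, zero_mul, map_zero]
    rfl⟩
  add_mem' := by
    rintro - - ⟨γ, rfl⟩ ⟨δ, rfl⟩
    refine ⟨γ + δ, ?_⟩
    ext x
    obtain ⟨a, rfl⟩ := QuotientAddGroup.mk_surjective x
    rw [torusCharacter_mk, map_add, add_mul, map_add]
    rfl
  neg_mem' := by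
    rintro - ⟨γ, rfl⟩
    refine ⟨-γ, ?_⟩
    ext x
    obtain ⟨a, rfl⟩ := QuotientAddGroup.mk_surjective x
    rw [torusCharacter_mk, map_neg, neg_mul, map_neg]
    rfl

theorem padic_eq_zero_of_forall_mul_norm_le_one (p : ℕ) [Fact p.Prime] {x : ℚ_[p]}
    (h : ∀ γ : ℚ, ‖(γ : ℚ_[p]) * x‖ ≤ 1) : x = 0 := by
  by_contra hx
  obtain ⟨k, hk⟩ := pow_unbounded_of_one_lt ‖x‖⁻¹
    (by exact_mod_cast (Fact.out : p.Prime).one_lt : (1 : ℝ) < p)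
  -- Multiplying by `p ^ (-k)` scales the norm by `p ^ k`, which exceeds `‖x‖⁻¹`.
  have := h ((p : ℚ) ^ k)⁻¹
  push_cast at this
  rw [norm_mul, norm_inv, norm_pow, Padic.norm_p, inv_pow, inv_inv] at this
  rw [inv_lt_iff_one_lt_mul₀ (norm_pos_iff.mpr hx)] at hk
  linarith

/-- The character with `γ = 1` makes the real coordinate rational, so a diagonal element can be
subtracted to make it zero. Then every rational multiple of the remaining finite adele is integral
at all primes, which forces it to vanish. -/
theorem eq_zero_of_forall_torusCharacters (x : AdelicTorus)
    (h : ∀ ψ ∈ torusCharacters, ψ x = 0) : x = 0 := by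
  obtain ⟨a, rfl⟩ := QuotientAddGroup.mk_surjective x
  have ha : ∀ γ : ℚ, adeleCharacter (adeleDiagonal γ * a) = 0 := fun γ => h _ ⟨γ, rfl⟩
  obtain ⟨q, hq⟩ : ∃ q : ℚ, a.1 = q := by
    have h1 : adeleCharacter a = 0 := by
      have := ha 1
      rwa [show adeleDiagonal 1 * a = a from Prod.ext (by simp [adeleDiagonal])
        (RestrictedProduct.ext _ _ fun p =>
          (congrArg (· * a.2 p) Rat.cast_one).trans (one_mul _))] at this
    obtain ⟨n, hn⟩ := (AddCircle.coe_eq_zero_iff (1 : ℝ)).mp h1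
    refine ⟨adeleFract a.2 - n, ?_⟩
    rw [zsmul_eq_mul, mul_one] at hn
    push_cast
    linarith
  set b := a - adeleDiagonal q with hb
  have hb1 : b.1 = 0 := by
    rw [hb, Prod.fst_sub, hq]
    exact sub_self _
  have hb2 : ∀ γ : ℚ, adeleCharacter (adeleDiagonal γ * b) = 0 := fun γ => by
    rw [hb, mul_sub, map_sub, ha, ← adeleDiagonal_mul, adeleCharacter_adeleDiagonal, sub_zero]
  have hb0 : b = 0 := by
    refine Prod.ext hb1 (RestrictedProduct.ext _ _ fun p => ?_)
    refine padic_eq_zero_of_forall_mul_norm_le_one (p : ℕ) fun γ => ?_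
    obtain ⟨n, hn⟩ := (AddCircle.coe_eq_zero_iff (1 : ℝ)).mp (hb2 γ)
    rw [zsmul_eq_mul, mul_one, Prod.fst_mul, hb1, mul_zero, neg_zero, zero_add] at hn
    have hfr : adeleFract (adeleDiagonal γ * b).2 = n := by exact_mod_cast hn.symm
    have := (PadicInt.subring (p : ℕ)).add_mem (norm_sub_adeleFract_le_one (adeleDiagonal γ * b).2 p)
      (Padic.norm_int_le_one n)
    rw [hfr, Rat.cast_intCast, sub_add_cancel] at this
    exact this
  rw [sub_eq_zero.mp hb0]
  exact (QuotientAddGroup.eq_zero_iff _).mpr ⟨q, rfl⟩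

/-- Continuous characters into a Hausdorff circle separate points, so discreteness of `ℚ` in `𝔸`
need not be proved. -/
instance adelicTorusT2Space : T2Space AdelicTorus := by
  refine ⟨fun x y hxy => ?_⟩
  obtain ⟨ψ, -, hne⟩ : ∃ ψ ∈ torusCharacters, ψ x ≠ ψ y := by
    by_contra! hall
    refine hxy (sub_eq_zero.mp (eq_zero_of_forall_torusCharacters _ fun ψ hψ => ?_))
    rw [map_sub, hall ψ hψ, sub_self]
  exact separated_by_continuous (map_continuous ψ) hne

instance adelicHaar_isAddHaarMeasure : adelicHaar.IsAddHaarMeasure :=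
  inferInstanceAs (Measure.addHaarMeasure (⊤ : PositiveCompacts AdelicTorus)).IsAddHaarMeasure

instance adelicHaar_regular : adelicHaar.Regular :=
  inferInstanceAs (Measure.addHaarMeasure (⊤ : PositiveCompacts AdelicTorus)).Regular

instance adelicHaar_isProbabilityMeasure : IsProbabilityMeasure adelicHaar :=
  ⟨Measure.addHaarMeasure_self (K₀ := (⊤ : PositiveCompacts AdelicTorus))⟩

theorem cast_adeleFract (x : FinAdele) :
    (adeleFract x : ℝ) = ∑ᶠ p : Nat.Primes, (padicFract (p : ℕ) (x p) : ℝ) :=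
  AddMonoidHom.map_finsum (Rat.castHom ℝ).toAddMonoidHom (finite_support_padicFract x)

theorem theorem1p1 (α : Adele) (hα : Irrational α.1) :
    boundedRemainderVolumes adelicHaar (QuotientAddGroup.mk α : AdelicTorus) =
      {v : ℝ | 0 ≤ v ∧ ∃ (γ : ℚ) (n : ℤ),
        v = -(γ : ℝ) * α.1
          + ∑ᶠ p : Nat.Primes, (padicFract (p : ℕ) ((γ : ℚ_[(p : ℕ)]) * α.2 p) : ℝ) + n} := by
  have hval : ∀ γ : ℚ, torusCharacter γ (QuotientAddGroup.mk α) = ((-(γ : ℝ) * α.1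
      + ∑ᶠ p : Nat.Primes, (padicFract (p : ℕ) ((γ : ℚ_[(p : ℕ)]) * α.2 p) : ℝ) : ℝ) :
        UnitAddCircle) := by
    intro γ
    rw [torusCharacter_mk, adeleCharacter_apply, cast_adeleFract, Prod.fst_mul, neg_mul]
    rfl
  ext v
  rw [mem_boundedRemainderVolumes_iff adelicHaar torusCharacters eq_zero_of_forall_torusCharacters]
  refine and_congr_right fun _ => ⟨?_, ?_⟩
  · rintro ⟨-, ⟨γ, rfl⟩, h⟩
    rw [hval, ← sub_eq_zero, ← AddCircle.coe_sub, AddCircle.coe_eq_zero_iff] at h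
    obtain ⟨n, hn⟩ := h
    rw [zsmul_eq_mul, mul_one] at hn
    exact ⟨γ, n, by rw [hn]; ring⟩
  · rintro ⟨γ, n, h⟩
    refine ⟨_, ⟨γ, rfl⟩, ?_⟩
    rw [hval, ← sub_eq_zero, ← AddCircle.coe_sub, AddCircle.coe_eq_zero_iff]
    exact ⟨n, by rw [h, zsmul_eq_mul]; ring⟩
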